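/- Let $\mathbb{T}^\infty$ be the infinite-dimensional torus with its normalized Haar measure (the product of the normalized Lebesgue measures of the countably many circles), with coordinates $z=(z_1,z_2,\ldots)$. Let $H^2(\mathbb{T}^\infty)$ be the closure in $L^2(\mathbb{T}^\infty)$ of the analytic polynomials, i.e. of the polynomials in finitely many of the variables $z_1,z_2,\ldots$, and let $P_+$ be the orthogonal projection of $L^2(\mathbb{T}^\infty)$ onto $H^2(\mathbb{T}^\infty)$. For $n\ge 1$ with prime factorization $n=\prod_j p_j^{\kappa_j}$, where $p_1<p_2<\cdots$ are the primes, put $z^{\kappa(n)}=\prod_j z_j^{\kappa_j}$. For a Dirichlet series $\varphi(s)=\sum_{n\ge1}\alpha(n)n^{-s}$ in $\mathcal{H}^2$, that is, with complex coefficients satisfying $\sum_{n\ge 1}|\alpha(n)|^2<\infty$, its Bohr lift is $\mathcal{B}\varphi(z)=\sum_{n\ge1}\alpha(n)z^{\kappa(n)}$, with convergence in $L^2(\mathbb{T}^\infty)$. For $\Phi\in L^2(\mathbb{T}^\infty)$, the Hankel form $H_\Phi$ is given on analytic polynomials $F,G$ by $$H_\Phi(F,G)=\langle FG,\Phi\rangle_{L^2(\mathbb{T}^\infty)}=\int_{\mathbb{T}^\infty}FG\,\overline{\Phi},$$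 and it is called bounded on $H^2(\mathbb{T}^\infty)\times H^2(\mathbb{T}^\infty)$ if it extends to a bounded bilinear form there. Theorem. Suppose that $\varphi(s)=\sum_{n\ge1}\alpha(n)n^{-s}$ is in $\mathcal{H}^2$ and that $\alpha$ is multiplicative, i.e. $\alpha(1)=1$ and $\alpha(mn)=\alpha(m)\alpha(n)$ whenever $\gcd(m,n)=1$. If $H_{\mathcal{B}\varphi}$ is bounded on $H^2(\mathbb{T}^\infty)\times H^2(\mathbb{T}^\infty)$, then there exists $\Psi\in L^\infty(\mathbb{T}^\infty)$ such that $\mathcal{B}\varphi=P_+\Psi$. Moreover, if $\alpha$ is completely multiplicative, i.e. $\alpha(mn)=\alpha(m)\alpha(n)$ for all $m,n\ge1$, then $H_{\mathcal{B}\varphi}$ is always bounded on $H^2(\mathbb{T}^\infty)\times H^2(\mathbb{T}^\infty)$. -/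

import Mathlib

open MeasureTheory
open scoped ENNReal

noncomputable section

/-- The normalized Haar measure on the infinite torus `𝕋^∞ = (ℝ/ℤ)^ℕ`: the product of the
normalized Lebesgue measures of the factors. -/
def torusMeasure : Measure (UnitAddTorus ℕ) :=
  Measure.infinitePi fun _ : ℕ => (AddCircle.haarAddCircle : Measure UnitAddCircle)

instance : IsProbabilityMeasure torusMeasure := by
  unfold torusMeasure; infer_instance

/-- The Hilbert space `L²(𝕋^∞)`. -/
abbrev TorusL2 : Type := Lp ℂ 2 torusMeasure

/-- The coordinate `z_j` on `𝕋^∞`: the point `θ` has `z_j = exp (2πi θ_j)`. -/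
def torusCoord (j : ℕ) : C(UnitAddTorus ℕ, ℂ) where
  toFun θ := (AddCircle.toCircle (θ j) : ℂ)
  continuous_toFun :=
    continuous_subtype_val.comp (AddCircle.continuous_toCircle.comp (continuous_apply j))

/-- Analytic polynomials in the variables `z_0, z_1, …`, as continuous functions on `𝕋^∞`. -/
def torusPoly : MvPolynomial ℕ ℂ →ₐ[ℂ] C(UnitAddTorus ℕ, ℂ) :=
  MvPolynomial.aeval torusCoord

/-- Analytic polynomials as elements of `L²(𝕋^∞)`. -/
def torusPolyL2 : MvPolynomial ℕ ℂ →ₗ[ℂ] TorusL2 :=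
  (ContinuousMap.toLp 2 torusMeasure ℂ).toLinearMap ∘ₗ torusPoly.toLinearMap

/-- The Hardy space `H²(𝕋^∞)`: the closure of the analytic polynomials in `L²(𝕋^∞)`. -/
def hardyH2 : Submodule ℂ TorusL2 :=
  (LinearMap.range torusPolyL2).topologicalClosure

instance : CompleteSpace hardyH2 :=
  (Submodule.isClosed_topologicalClosure _).completeSpace_coe

/-- An analytic polynomial as an element of `H²(𝕋^∞)`. -/
def hardyPoly (P : MvPolynomial ℕ ℂ) : hardyH2 :=
  ⟨torusPolyL2 P, Submodule.le_topologicalClosure _ (LinearMap.mem_range_self _ P)⟩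

/-- The Riesz projection `P_+`: the orthogonal projection of `L²(𝕋^∞)` onto `H²(𝕋^∞)`. -/
def rieszProj : TorusL2 →L[ℂ] TorusL2 := hardyH2.starProjection

/-- The Hankel form `H_Φ(F, G) = ⟨F G, Φ⟩ = ∫ F G conj(Φ)` on polynomials `F`, `G`
(Mathlib's inner product is conjugate-linear in its first argument). -/
def hankelForm (Φ : TorusL2) (F G : MvPolynomial ℕ ℂ) : ℂ :=
  inner ℂ Φ (torusPolyL2 (F * G))

/-- `H_Φ` is bounded on `H²(𝕋^∞) × H²(𝕋^∞)`: it extends from polynomials to a bounded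
bilinear form. -/
def IsBoundedHankelForm (Φ : TorusL2) : Prop :=
  ∃ B : hardyH2 →L[ℂ] hardyH2 →L[ℂ] ℂ,
    ∀ F G : MvPolynomial ℕ ℂ, B (hardyPoly F) (hardyPoly G) = hankelForm Φ F G

/-- The multi-index `κ(n)` of the prime factorization `n = ∏ p_j ^ κ_j`, where
`p_0 = 2, p_1 = 3, …` are the primes in increasing order. -/
def primeExponents (n : ℕ) : ℕ →₀ ℕ :=
  n.factorization.comapDomain (Nat.nth Nat.Prime)
    (Nat.nth_injective Nat.infinite_setOfPred_prime).injOn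

/-- The Dirichlet series `∑ α(n) n^{-s}` is in `ℋ²`: its coefficients are square summable. -/
def MemDirichletH2 (α : ArithmeticFunction ℂ) : Prop :=
  Summable fun n : ℕ => ‖α n‖ ^ 2

/-- The Bohr lift `∑ α(n) z^{κ(n)}` of the Dirichlet series `∑ α(n) n^{-s}` in `ℋ²`, with the
series summed in `L²(𝕋^∞)` (recall `α 0 = 0`, so that the sum is over `n ≥ 1`). -/
def bohrLift (α : ArithmeticFunction ℂ) : TorusL2 :=
  ∑' n : ℕ, α n • torusPolyL2 (MvPolynomial.monomial (primeExponents n) 1)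


theorem torusPoly_monomial (k : ℕ →₀ ℕ) (θ : UnitAddTorus ℕ) :
    torusPoly (MvPolynomial.monomial k 1) θ = k.prod fun j e => fourier e (θ j) := by
  simp only [torusPoly, MvPolynomial.aeval_monomial, map_one, one_mul, Finsupp.prod,
    ContinuousMap.prod_apply, ContinuousMap.pow_apply, torusCoord, ContinuousMap.coe_mk,
    fourier_apply]
  refine Finset.prod_congr rfl fun j _ => ?_
  simp [AddCircle.toCircle_nsmul]

theorem integral_fourier_haar (n : ℤ) :
    ∫ x : UnitAddCircle, fourier n x ∂AddCircle.haarAddCircle = if n = 0 then 1 else 0 := by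
  have h := orthonormal_iff_ite.mp (orthonormal_fourier (T := 1)) 0 n
  have h2 := ContinuousMap.inner_toLp (𝕜 := ℂ) (@AddCircle.haarAddCircle 1 _)
    (fourier 0) (fourier n)
  simp only [fourierLp] at h
  rw [h2] at h
  simp only [fourier_zero, map_one, mul_one] at h
  rw [h]; simp [eq_comm]

theorem orthonormal_monomials :
    Orthonormal ℂ fun k : ℕ →₀ ℕ => torusPolyL2 (MvPolynomial.monomial k 1) := by
  rw [orthonormal_iff_ite]
  intro k l
  have h := ContinuousMap.inner_toLp (𝕜 := ℂ) torusMeasure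
    (torusPoly (MvPolynomial.monomial k 1)) (torusPoly (MvPolynomial.monomial l 1))
  change inner ℂ (ContinuousMap.toLp 2 torusMeasure ℂ _)
    (ContinuousMap.toLp 2 torusMeasure ℂ _) = _
  erw [h]
  classical
  set s := k.support ∪ l.support
  have key : ∀ θ : UnitAddTorus ℕ, torusPoly (MvPolynomial.monomial l 1) θ *
      (starRingEnd ℂ) (torusPoly (MvPolynomial.monomial k 1) θ) =
      (fun y : s → UnitAddCircle => ∏ i : s, fourier ((l i : ℤ) - k i) (y i)) (s.restrict θ) := by
    intro θ
    rw [torusPoly_monomial, torusPoly_monomial,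
      Finsupp.prod_of_support_subset l (s := s) Finset.subset_union_right _ (by simp),
      Finsupp.prod_of_support_subset k (s := s) Finset.subset_union_left _ (by simp),
      map_prod, ← Finset.prod_mul_distrib]
    simp only [Finset.restrict]
    rw [Finset.prod_coe_sort s (fun i => fourier ((l i : ℤ) - k i) (θ i))]
    refine Finset.prod_congr rfl fun j _ => ?_
    rw [sub_eq_add_neg, fourier_add, fourier_neg]
  rw [integral_congr_ae (Filter.Eventually.of_forall key), torusMeasure]
  refine (integral_restrict_infinitePi (s := s)
    (μ := fun _ : ℕ => (AddCircle.haarAddCircle : Measure UnitAddCircle))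
    (f := fun y : s → UnitAddCircle => ∏ i : s, fourier ((l i : ℤ) - k i) (y i)) ?_).trans ?_
  rotate_left
  · rw [integral_fintype_prod_eq_prod]
    simp only [integral_fourier_haar]
    split_ifs with hkl
    · subst hkl; simp
    · obtain ⟨j, hj⟩ := Finsupp.ne_iff.mp hkl
      have hjs : j ∈ s := by
        simp only [s, Finset.mem_union, Finsupp.mem_support_iff]; omega
      exact Finset.prod_eq_zero (Finset.mem_univ (⟨j, hjs⟩ : s)) (if_neg (by simp; omega))
  · exact Continuous.aestronglyMeasurable (by fun_prop)

theorem primeExponents_injOn : Set.InjOn primeExponents {n | n ≠ 0} := by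
  intro m hm n hn h
  refine Nat.eq_of_factorization_eq hm hn fun p => ?_
  by_cases hp : p.Prime
  · obtain ⟨j, rfl⟩ : ∃ j, Nat.nth Nat.Prime j = p := by
      exact ⟨Nat.count Nat.Prime p, Nat.nth_count hp⟩
    exact DFunLike.congr_fun h j
  · simp [Nat.factorization_eq_zero_of_not_prime, hp]

/-- The series defining the Bohr lift converges in `L²(𝕋^∞)`. -/
theorem hasSum_bohrLift {α : ArithmeticFunction ℂ} (hα : MemDirichletH2 α) :
    HasSum (fun n : ℕ => α n • torusPolyL2 (MvPolynomial.monomial (primeExponents n) 1))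
      (bohrLift α) := by
  refine Summable.hasSum ?_
  have hinj : Function.Injective fun n : {n : ℕ // n ≠ 0} => primeExponents n :=
    fun m n h => Subtype.ext (primeExponents_injOn m.2 n.2 h)
  have ho := (orthonormal_monomials.comp _ hinj).orthogonalFamily
  have hs := (ho.summable_iff_norm_sq_summable fun n => α n).mpr
    (hα.comp_injective Subtype.val_injective)
  refine (Function.Injective.summable_iff (g := ((↑) : {n : ℕ // n ≠ 0} → ℕ))
    Subtype.val_injective ?_).mp hs
  intro n hn
  have : n = 0 := by simpa using hn
  simp [this]

/-!
Bounded Hankel forms of functionals `l` that are multiplicative across the variables reduce to one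
variable. Let `c_j` be the least bound of the Hankel form of `l` restricted to polynomials in
`z_j`. Testing the form of `l` on products `∏ F_j(z_j)`, whose `L²` norms multiply, gives
`∏ c_j ≤ C`, where `C` bounds the form of `l`. On the circle every polynomial factors as `P = FG`
with `|F| = |G|` on the unit circle, hence `|l(P)| ≤ c_j ‖F‖₂ ‖G‖₂ = c_j ‖P‖₁`, and Hahn–Banach
yields a symbol `ψ_j` with `‖ψ_j‖_∞ ≤ c_j`. If `P` is a polynomial in the variables from a finite
set `s`, then `∏_{j ∈ s} ψ_j(z_j)` represents `l` on `P` and has sup norm at most `C`; therefore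
`|l(P)| ≤ C ‖P‖₁` for all polynomials, and Hahn–Banach produces the bounded symbol `Ψ`.

For completely multiplicative coefficients the functional itself is multiplicative, so the Hankel
form is the rank-one form `l(F) l(G)`.
-/

noncomputable section

open Metric
open scoped NNReal ComplexConjugate Polynomial

theorem exists_dual_comp_eq_of_le_seminorm {𝕜 V E : Type*} [RCLike 𝕜] [AddCommGroup V]
    [Module 𝕜 V] [AddCommGroup E] [Module 𝕜 E] (T : V →ₗ[𝕜] E) (l : V →ₗ[𝕜] 𝕜)
    (p : Seminorm 𝕜 E) (h : ∀ v, ‖l v‖ ≤ p (T v)) :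
    ∃ g : E →ₗ[𝕜] 𝕜, (∀ v, g (T v) = l v) ∧ ∀ x, ‖g x‖ ≤ p x := by
  have hker : l ∈ LinearMap.range T.dualMap := by
    rw [LinearMap.range_dualMap_eq_dualAnnihilator_ker, Submodule.mem_dualAnnihilator]
    intro v hv
    simpa [LinearMap.mem_ker.mp hv] using h v
  obtain ⟨l', rfl⟩ := hker
  obtain ⟨g, hg, hgp⟩ := Module.Dual.exists_extension_of_le_seminorm (p := p)
    (LinearMap.range T) (l'.domRestrict (LinearMap.range T)) (by rintro ⟨_, v, rfl⟩; exact h v)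
  exact ⟨g, fun v => hg ⟨T v, v, rfl⟩, hgp⟩

section BoundedSymbol

variable {X : Type*} [MeasurableSpace X] {μ : Measure X} [IsProbabilityMeasure μ]

theorem integrable_coeFn_Lp_two (f : Lp ℂ 2 μ) : Integrable f μ :=
  (Lp.memLp f).integrable one_le_two

/-- The `L¹` norm, as a seminorm on `L²` of a probability space. -/
def l1Seminorm (μ : Measure X) [IsProbabilityMeasure μ] : Seminorm ℂ (Lp ℂ 2 μ) :=
  Seminorm.of (fun f => ∫ x, ‖f x‖ ∂μ)
    (fun f g => by
      rw [← integral_add (integrable_coeFn_Lp_two f).norm (integrable_coeFn_Lp_two g).norm]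
      refine integral_mono_ae (integrable_coeFn_Lp_two _).norm
        ((integrable_coeFn_Lp_two f).norm.add (integrable_coeFn_Lp_two g).norm) ?_
      filter_upwards [Lp.coeFn_add f g] with x hx
      exact hx ▸ norm_add_le (f x) (g x))
    (fun a f => by
      rw [← integral_const_mul]
      refine integral_congr_ae ?_
      filter_upwards [Lp.coeFn_smul a f] with x hx
      rw [hx, Pi.smul_apply, norm_smul])

theorem l1Seminorm_apply (f : Lp ℂ 2 μ) : l1Seminorm μ f = ∫ x, ‖f x‖ ∂μ := rfl

theorem l1Seminorm_of_ae_eq {f : Lp ℂ 2 μ} {g : X → ℂ} (h : f =ᵐ[μ] g) :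
    l1Seminorm μ f = ∫ x, ‖g x‖ ∂μ :=
  integral_congr_ae (h.fun_comp norm)

theorem l1Seminorm_le_norm (f : Lp ℂ 2 μ) : l1Seminorm μ f ≤ ‖f‖ := by
  have h := eLpNorm_le_eLpNorm_of_exponent_le (p := 1) (q := 2) one_le_two
    (Lp.aestronglyMeasurable f)
  rw [l1Seminorm_apply, integral_norm_eq_lintegral_enorm (Lp.aestronglyMeasurable f),
    ← eLpNorm_one_eq_lintegral_enorm, Lp.norm_def]
  exact ENNReal.toReal_mono (Lp.eLpNorm_ne_top f) h

theorem norm_inner_le_of_ae_norm_le {c : ℝ} {ψ : Lp ℂ 2 μ} (hψ : ∀ᵐ x ∂μ, ‖ψ x‖ ≤ c)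
    (f : Lp ℂ 2 μ) : ‖inner ℂ ψ f‖ ≤ c * l1Seminorm μ f := by
  rw [L2.inner_def, l1Seminorm_apply, ← integral_const_mul]
  refine norm_integral_le_of_norm_le ((integrable_coeFn_Lp_two f).norm.const_mul c) ?_
  filter_upwards [hψ] with x hx
  exact (norm_inner_le_norm _ _).trans (by gcongr)

theorem ae_norm_le_of_norm_inner_le {c : ℝ} {ψ : Lp ℂ 2 μ}
    (h : ∀ f, ‖inner ℂ ψ f‖ ≤ c * l1Seminorm μ f) : ∀ᵐ x ∂μ, ‖ψ x‖ ≤ c := by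
  refine ae_le_of_forall_setIntegral_le (integrable_coeFn_Lp_two ψ).norm (integrable_const c)
    fun S hS _ => ?_
  -- Test against the phase of `ψ` on `S`.
  let phase : X → ℂ := fun x => ψ x / ‖ψ x‖
  have hψ : Measurable ψ := (Lp.stronglyMeasurable ψ).measurable
  have norm_phase_le (x : X) : ‖phase x‖ ≤ 1 := by
    simpa [phase] using div_self_le_one ‖ψ x‖
  have phase_mul (x : X) : phase x * conj (ψ x) = ‖ψ x‖ := by
    rw [div_mul_eq_mul_div, Complex.mul_conj', sq, mul_self_div_self]
  have hphase : MemLp (S.indicator phase) 2 μ :=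
    .indicator hS <| .of_bound (hψ.div (by fun_prop)).aestronglyMeasurable 1
      (.of_forall norm_phase_le)
  have hinner : inner ℂ ψ (hphase.toLp _) = ((∫ x in S, ‖ψ x‖ ∂μ : ℝ) : ℂ) := by
    rw [L2.inner_def, ← integral_complex_ofReal, ← integral_indicator hS]
    refine integral_congr_ae ?_
    filter_upwards [hphase.coeFn_toLp] with x hx
    rw [hx, RCLike.inner_apply]
    by_cases hxS : x ∈ S <;> simp [hxS, phase_mul]
  have hl1 : l1Seminorm μ (hphase.toLp _) ≤ μ.real S := by
    rw [l1Seminorm_of_ae_eq hphase.coeFn_toLp, ← integral_indicator_one hS]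
    refine integral_mono (hphase.integrable one_le_two).norm ((integrable_const 1).indicator hS)
      fun x => ?_
    by_cases hxS : x ∈ S <;> simp [hxS, norm_phase_le]
  have hc : 0 ≤ c := by
    have hone := h ((memLp_const (1 : ℂ)).toLp _)
    rw [l1Seminorm_of_ae_eq (MemLp.coeFn_toLp _)] at hone
    simpa using (norm_nonneg _).trans hone
  calc ∫ x in S, ‖ψ x‖ ∂μ = ‖inner ℂ ψ (hphase.toLp _)‖ := by
        rw [hinner, Complex.norm_real, Real.norm_of_nonneg (by positivity)]
    _ ≤ c * μ.real S := (h _).trans (by gcongr)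
    _ = ∫ _ in S, c ∂μ := by rw [setIntegral_const, smul_eq_mul, mul_comm]

theorem exists_symbol_of_norm_le_l1Seminorm {V : Type*} [AddCommGroup V] [Module ℂ V]
    (T : V →ₗ[ℂ] Lp ℂ 2 μ) (l : V →ₗ[ℂ] ℂ) (c : ℝ≥0) (h : ∀ v, ‖l v‖ ≤ c * l1Seminorm μ (T v)) :
    ∃ ψ : Lp ℂ 2 μ, (∀ᵐ x ∂μ, ‖ψ x‖ ≤ c) ∧ ∀ v, inner ℂ ψ (T v) = l v := by
  obtain ⟨g, hgT, hg⟩ := exists_dual_comp_eq_of_le_seminorm T l (c • l1Seminorm μ) h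
  let G : StrongDual ℂ (Lp ℂ 2 μ) := g.mkContinuous c fun f =>
    (hg f).trans (mul_le_mul_of_nonneg_left (l1Seminorm_le_norm f) c.2)
  have hG (f : Lp ℂ 2 μ) : inner ℂ ((InnerProductSpace.toDual ℂ _).symm G) f = g f :=
    InnerProductSpace.toDual_symm_apply
  refine ⟨(InnerProductSpace.toDual ℂ _).symm G,
    ae_norm_le_of_norm_inner_le fun f => ?_, fun v => by rw [hG, hgT]⟩
  rw [hG]
  exact hg f

end BoundedSymbol

section BalancedFactorization

/-- `f` agrees on the unit circle with a product of two functions of the disk algebra whose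
moduli are equal there. -/
def HasBalancedFactorization (f : ℂ → ℂ) : Prop :=
  ∃ F G : ℂ → ℂ, DiffContOnCl ℂ F (ball 0 1) ∧ DiffContOnCl ℂ G (ball 0 1) ∧
    ∀ z, ‖z‖ = 1 → F z * G z = f z ∧ ‖F z‖ = ‖G z‖

namespace HasBalancedFactorization

theorem mul {f g : ℂ → ℂ} (hf : HasBalancedFactorization f) (hg : HasBalancedFactorization g) :
    HasBalancedFactorization fun z => f z * g z := by
  obtain ⟨F, G, hF, hG, h⟩ := hf
  obtain ⟨F', G', hF', hG', h'⟩ := hg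
  refine ⟨F • F', G • G', hF.smul hF', hG.smul hG', fun z hz => ⟨?_, ?_⟩⟩
  · simp only [Pi.smul_apply', smul_eq_mul, ← (h z hz).1, ← (h' z hz).1]
    ring
  · simp [(h z hz).2, (h' z hz).2]

theorem congr {f g : ℂ → ℂ} (hf : HasBalancedFactorization f) (h : ∀ z, ‖z‖ = 1 → f z = g z) :
    HasBalancedFactorization g := by
  obtain ⟨F, G, hF, hG, hFG⟩ := hf
  exact ⟨F, G, hF, hG, fun z hz => ⟨(hFG z hz).1.trans (h z hz), (hFG z hz).2⟩⟩

theorem of_mul_self {F f : ℂ → ℂ} (hF : DiffContOnCl ℂ F (ball 0 1)) (h : ∀ z, F z * F z = f z) :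
    HasBalancedFactorization f :=
  ⟨F, F, hF, hF, fun z _ => ⟨h z, rfl⟩⟩

theorem of_norm_eq_one {f : ℂ → ℂ} (hf : DiffContOnCl ℂ f (ball 0 1))
    (h : ∀ z, ‖z‖ = 1 → ‖f z‖ = 1) : HasBalancedFactorization f :=
  ⟨f, fun _ => 1, hf, diffContOnCl_const, fun z hz => ⟨mul_one _, by simp [h z hz]⟩⟩

theorem const (a : ℂ) : HasBalancedFactorization fun _ => a := by
  obtain ⟨w, rfl⟩ := IsAlgClosed.exists_eq_mul_self a
  exact of_mul_self diffContOnCl_const fun _ => rfl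

end HasBalancedFactorization

theorem diffContOnCl_sqrt_one_sub_mul {b : ℂ} (hb : ‖b‖ ≤ 1) :
    DiffContOnCl ℂ (fun z => Complex.sqrt (1 - b * z)) (ball 0 1) := by
  refine .mk_ball (fun z hz => ?_) fun z hz => ?_
  · have hbz : ‖-(b * z)‖ < 1 := by
      rw [norm_neg, norm_mul]
      exact (mul_le_of_le_one_left (norm_nonneg z) hb).trans_lt (mem_ball_zero_iff.mp hz)
    have hslit : 1 - b * z ∈ Complex.slitPlane := by
      simpa only [← sub_eq_add_neg] using Complex.mem_slitPlane_of_norm_lt_one hbz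
    exact (DifferentiableAt.comp (f := fun z => 1 - b * z) z
      (Complex.differentiableAt_sqrt hslit) (by fun_prop)).differentiableWithinAt
  · have hbz : ‖b * z‖ ≤ 1 := by
      rw [norm_mul]
      exact mul_le_one₀ hb (norm_nonneg z) (mem_closedBall_zero_iff.mp hz)
    have hre : 0 ≤ (1 - b * z).re := by simpa using (Complex.re_le_norm _).trans hbz
    exact (ContinuousAt.comp (f := fun z => 1 - b * z) (Complex.continuousAt_sqrt (.inl hre))
      (by fun_prop)).continuousWithinAt

theorem hasBalancedFactorization_one_sub_mul {b : ℂ} (hb : ‖b‖ ≤ 1) :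
    HasBalancedFactorization fun z => 1 - b * z :=
  .of_mul_self (diffContOnCl_sqrt_one_sub_mul hb) fun z => by simp [Complex.sqrt, ← sq]

theorem one_sub_conj_mul_ne_zero {a z : ℂ} (ha : ‖a‖ < 1) (hz : ‖z‖ ≤ 1) : 1 - conj a * z ≠ 0 := by
  refine sub_ne_zero.mpr fun h => ?_
  have : ‖conj a * z‖ < 1 := by
    rw [norm_mul, RCLike.norm_conj]
    exact (mul_le_of_le_one_right (norm_nonneg a) hz).trans_lt ha
  simp [← h] at this

theorem norm_sub_eq_norm_one_sub_conj_mul (a : ℂ) {z : ℂ} (hz : ‖z‖ = 1) :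
    ‖z - a‖ = ‖1 - conj a * z‖ := by
  have h : 1 - conj a * z = z * conj (z - a) := by
    rw [map_sub, mul_sub, Complex.mul_conj', hz, Complex.ofReal_one, one_pow, mul_comm z]
  rw [h, norm_mul, hz, one_mul, RCLike.norm_conj]

theorem hasBalancedFactorization_blaschke {a : ℂ} (ha : ‖a‖ < 1) :
    HasBalancedFactorization fun z => (1 - conj a * z)⁻¹ * (z - a) := by
  have hden : Differentiable ℂ fun z => 1 - conj a * z := by fun_prop
  have hnum : Differentiable ℂ fun z => z - a := by fun_prop
  refine .of_norm_eq_one ((hden.diffContOnCl.inv fun z hz => ?_).smul hnum.diffContOnCl)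
    fun z hz => ?_
  · exact one_sub_conj_mul_ne_zero ha
      (mem_closedBall_zero_iff.mp (closure_ball_subset_closedBall hz))
  · rw [norm_mul, norm_inv, norm_sub_eq_norm_one_sub_conj_mul a hz,
      inv_mul_cancel₀ (norm_ne_zero_iff.mpr (one_sub_conj_mul_ne_zero ha hz.le))]

theorem hasBalancedFactorization_sub (a : ℂ) : HasBalancedFactorization fun z => z - a := by
  rcases lt_or_ge ‖a‖ 1 with ha | ha
  · refine ((hasBalancedFactorization_one_sub_mul (RCLike.norm_conj a ▸ ha.le)).mul
      (hasBalancedFactorization_blaschke ha)).congr fun z hz => ?_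
    rw [mul_inv_cancel_left₀ (one_sub_conj_mul_ne_zero ha hz.le)]
  · have ha0 : a ≠ 0 := norm_pos_iff.mp (one_pos.trans_le ha)
    have hinv : ‖a⁻¹‖ ≤ 1 := norm_inv a ▸ inv_le_one_of_one_le₀ ha
    refine ((HasBalancedFactorization.const (-a)).mul
      (hasBalancedFactorization_one_sub_mul hinv)).congr fun z _ => ?_
    field

theorem hasBalancedFactorization_eval (P : ℂ[X]) : HasBalancedFactorization fun z => P.eval z := by
  rw [(IsAlgClosed.splits P).eq_prod_roots]
  simp only [Polynomial.eval_mul, Polynomial.eval_C]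
  refine (HasBalancedFactorization.const _).mul ?_
  induction P.roots using Multiset.induction with
  | empty => simpa using HasBalancedFactorization.const 1
  | cons a s ih => simpa using (hasBalancedFactorization_sub a).mul ih

end BalancedFactorization

theorem prod_le_of_isLeast {ι : Type*} {X : ι → Type*} [∀ i, Nonempty (X i)] (s : Finset ι)
    {f g : ∀ i, X i → ℝ≥0} {c : ι → ℝ≥0} {C : ℝ≥0}
    (hc : ∀ i, IsLeast {b | ∀ x, f i x ≤ b * g i x} (c i))
    (h : ∀ x : ∀ i, X i, ∏ i ∈ s, f i (x i) ≤ C * ∏ i ∈ s, g i (x i)) : ∏ i ∈ s, c i ≤ C := by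
  classical
  induction s using Finset.induction_on generalizing C with
  | empty => simpa using h fun _ => Classical.arbitrary _
  | insert a s ha ih =>
    rw [Finset.prod_insert ha]
    rcases eq_zero_or_pos (∏ i ∈ s, c i) with h0 | hpos
    · simp [h0]
    refine (le_div_iff₀ hpos).mp ((hc a).2 fun y => ?_)
    rcases eq_zero_or_pos (f a y) with hy | hy
    · simp [hy]
    have hrest : ∏ i ∈ s, c i ≤ C * g a y / f a y := ih fun x => by
      have hx := h (Function.update x a y)
      have hf (i) (hi : i ∈ s) : Function.update x a y i = x i :=
        Function.update_of_ne (ne_of_mem_of_not_mem hi ha) _ _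
      rw [Finset.prod_insert ha, Finset.prod_insert ha, Function.update_self,
        Finset.prod_congr rfl fun i hi => by rw [hf i hi],
        Finset.prod_congr (f := fun i => g i _) rfl fun i hi => by rw [hf i hi]] at hx
      rw [div_mul_eq_mul_div, le_div_iff₀ hy, mul_comm, mul_assoc]
      exact hx
    rw [le_div_iff₀ hy] at hrest
    rw [div_mul_eq_mul_div, le_div_iff₀ hpos, mul_comm]
    exact hrest

section HankelBound

variable {𝕜 A E : Type*} [RCLike 𝕜] [Ring A] [Algebra 𝕜 A] [SeminormedAddCommGroup E] [Module 𝕜 E]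

/-- The Hankel form `(F, G) ↦ l (F * G)` is bounded by `c` for the seminorm pulled back along
`T`. -/
def IsHankelBound (T : A →ₗ[𝕜] E) (l : A →ₗ[𝕜] 𝕜) (c : ℝ≥0) : Prop :=
  ∀ F G, ‖l (F * G)‖₊ ≤ c * (‖T F‖₊ * ‖T G‖₊)

theorem IsHankelBound.exists_isLeast {T : A →ₗ[𝕜] E} {l : A →ₗ[𝕜] 𝕜} {c : ℝ≥0}
    (h : IsHankelBound T l c) : ∃ c₀, IsLeast {c | IsHankelBound T l c} c₀ := by
  have hclosed : IsClosed {c | IsHankelBound T l c} := by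
    simp only [IsHankelBound, Set.ofPred_forall]
    exact isClosed_iInter fun F => isClosed_iInter fun G =>
      isClosed_le continuous_const (continuous_mul_const _)
  exact ⟨_, hclosed.csInf_mem ⟨c, h⟩ (OrderBot.bddBelow _), fun _ hb => csInf_le' hb⟩

theorem isHankelBound_of_continuousLinearMap {H : Type*} [SeminormedAddCommGroup H]
    [NormedSpace 𝕜 H] {T : A →ₗ[𝕜] E} {l : A →ₗ[𝕜] 𝕜} {t : A → H} (B : H →L[𝕜] H →L[𝕜] 𝕜)
    (ht : ∀ F, ‖t F‖ = ‖T F‖) (hB : ∀ F G, B (t F) (t G) = l (F * G)) :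
    IsHankelBound T l ‖B‖₊ := fun F G => by
  rw [← NNReal.coe_le_coe]
  push_cast
  rw [← hB, ← ht, ← ht, ← mul_assoc]
  exact B.le_opNorm₂ _ _

end HankelBound

section ContinuousFunctions

variable {X : Type*} [TopologicalSpace X] [CompactSpace X] [MeasurableSpace X] [BorelSpace X]
  {μ : Measure X}

theorem norm_toLp_two_sq [IsFiniteMeasure μ] (f : C(X, ℂ)) :
    ‖ContinuousMap.toLp 2 μ ℂ f‖ ^ 2 = ∫ x, ‖f x‖ ^ 2 ∂μ := by
  have h : ((‖ContinuousMap.toLp 2 μ ℂ f‖ ^ 2 : ℝ) : ℂ) = ((∫ x, ‖f x‖ ^ 2 ∂μ : ℝ) : ℂ) := by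
    rw [← integral_complex_ofReal, Complex.ofReal_pow]
    refine (inner_self_eq_norm_sq_to_K _).symm.trans
      ((ContinuousMap.inner_toLp (𝕜 := ℂ) μ f f).trans (integral_congr_ae (.of_forall fun x => ?_)))
    simp [Complex.mul_conj']
  exact Complex.ofReal_injective h

theorem norm_toLp_mul_norm_toLp_of_norm_eq [IsFiniteMeasure μ] {F G : C(X, ℂ)}
    (h : ∀ x, ‖F x‖ = ‖G x‖) :
    ‖ContinuousMap.toLp 2 μ ℂ F‖ * ‖ContinuousMap.toLp 2 μ ℂ G‖ = ∫ x, ‖(F * G) x‖ ∂μ := by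
  have hFG : ‖ContinuousMap.toLp 2 μ ℂ F‖ = ‖ContinuousMap.toLp 2 μ ℂ G‖ := by
    rw [← pow_left_inj₀ (norm_nonneg _) (norm_nonneg _) two_ne_zero, norm_toLp_two_sq,
      norm_toLp_two_sq]
    simp only [h]
  rw [hFG, ← sq, norm_toLp_two_sq]
  simp only [ContinuousMap.mul_apply, norm_mul, h, sq]

theorem l1Seminorm_toLp_continuousMap [IsProbabilityMeasure μ] (f : C(X, ℂ)) :
    l1Seminorm μ (ContinuousMap.toLp 2 μ ℂ f) = ∫ x, ‖f x‖ ∂μ :=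
  l1Seminorm_of_ae_eq (ContinuousMap.coeFn_toLp (𝕜 := ℂ) μ f)

theorem IsHankelBound.norm_le_of_mem_closure [IsFiniteMeasure μ] {A : Type*} [Ring A] [Algebra ℂ A]
    {T : A →ₐ[ℂ] C(X, ℂ)} {l : A →ₗ[ℂ] ℂ} {c : ℝ≥0}
    (h : IsHankelBound ((ContinuousMap.toLp 2 μ ℂ).toLinearMap ∘ₗ T.toLinearMap) l c)
    {F G : C(X, ℂ)} (hF : F ∈ closure (Set.range T)) (hG : G ∈ closure (Set.range T)) {P : A}
    (hP : T P = F * G) :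
    ‖l P‖ ≤ c * (‖ContinuousMap.toLp 2 μ ℂ F‖ * ‖ContinuousMap.toLp 2 μ ℂ G‖) := by
  let N : C(X, ℂ) → ℝ := fun f => ‖ContinuousMap.toLp 2 μ ℂ f‖
  have hN : Continuous N := (ContinuousMap.toLp 2 μ ℂ).continuous.norm
  have hl (Q R : A) : ‖l (Q * R)‖ ≤ c * (N (T Q) * N (T R)) := h Q R
  -- The error term vanishes at `(F, G)` and makes the inequality a closed condition.
  have hrange : ∀ p ∈ Set.range T ×ˢ Set.range T,
      ‖l P‖ ≤ c * (N p.1 * N p.2) + c * (N (T P - p.1 * p.2) * N 1) := by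
    rintro ⟨_, _⟩ ⟨⟨Q, rfl⟩, ⟨R, rfl⟩⟩
    calc ‖l P‖ = ‖l (Q * R) + l ((P - Q * R) * 1)‖ := by
          rw [mul_one, ← map_add, add_sub_cancel]
      _ ≤ ‖l (Q * R)‖ + ‖l ((P - Q * R) * 1)‖ := norm_add_le _ _
      _ ≤ _ := add_le_add (hl Q R)
          (by simpa only [map_sub, map_mul, map_one] using hl (P - Q * R) 1)
  have hFG := le_on_closure (x := (F, G)) hrange continuousOn_const (by fun_prop)
    (by rw [closure_prod_eq]; exact ⟨hF, hG⟩)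
  simpa [N, hP] using hFG

end ContinuousFunctions

section Circle

/-- The polynomial `∑ c_k z ^ k` as a continuous function on the circle. -/
def circlePoly : ℂ[X] →ₐ[ℂ] C(UnitAddCircle, ℂ) :=
  Polynomial.aeval (fourier 1)

/-- Polynomials on the circle, as elements of `L²`. -/
def circlePolyL2 : ℂ[X] →ₗ[ℂ] Lp ℂ 2 (AddCircle.haarAddCircle : Measure UnitAddCircle) :=
  (ContinuousMap.toLp 2 AddCircle.haarAddCircle ℂ).toLinearMap ∘ₗ circlePoly.toLinearMap

theorem circlePoly_apply (P : ℂ[X]) (θ : UnitAddCircle) :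
    circlePoly P θ = P.eval (fourier 1 θ) := by
  have h := Polynomial.aeval_algHom_apply (ContinuousMap.evalAlgHom ℂ ℂ θ)
    (fourier 1 : C(UnitAddCircle, ℂ)) P
  rw [Polynomial.coe_aeval_eq_eval] at h
  exact h.symm

theorem norm_fourier_one (θ : UnitAddCircle) : ‖fourier 1 θ‖ = 1 := by
  rw [fourier_apply]
  exact Circle.norm_coe _

theorem mem_closure_range_circlePoly_of_differentiableOn {h : ℂ → ℂ} {r R : ℝ≥0} (hrR : r < R)
    (hd : DifferentiableOn ℂ h (closedBall 0 R)) {f : C(UnitAddCircle, ℂ)}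
    (hf : ∀ θ, f θ = h (r * fourier 1 θ)) : f ∈ closure (Set.range circlePoly) := by
  have hp := hd.hasFPowerSeriesOnBall (pos_of_gt hrR)
  set p := cauchyPowerSeries h 0 R
  obtain ⟨ρ, hrρ, hρR⟩ := exists_between hrR
  have htaylor := tendstoUniformlyOn_iff.mp (hp.tendstoUniformlyOn (mod_cast hρR))
  let taylor (n : ℕ) : ℂ[X] :=
    ∑ k ∈ Finset.range n, Polynomial.C (p.coeff k * r ^ k) * Polynomial.X ^ k
  have htaylor_apply (n : ℕ) (θ : UnitAddCircle) :
      circlePoly (taylor n) θ = p.partialSum n (r * fourier 1 θ) := by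
    simp only [taylor, circlePoly_apply, FormalMultilinearSeries.partialSum,
      Polynomial.eval_finsetSum, Polynomial.eval_mul, Polynomial.eval_C, Polynomial.eval_pow,
      Polynomial.eval_X, FormalMultilinearSeries.apply_eq_pow_smul_coeff, smul_eq_mul, mul_pow]
    exact Finset.sum_congr rfl fun k _ => by ring
  refine mem_closure_of_tendsto (b := Filter.atTop) (f := fun n => circlePoly (taylor n)) ?_
    (.of_forall fun n => ⟨_, rfl⟩)
  rw [ContinuousMap.tendsto_iff_tendstoUniformly, tendstoUniformly_iff]
  intro ε hε
  filter_upwards [htaylor ε hε] with n hn θ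
  have hθ : r * fourier 1 θ ∈ ball (0 : ℂ) ρ := by
    rw [mem_ball_zero_iff, norm_mul, norm_fourier_one, mul_one]
    simpa using hrρ
  simpa only [zero_add, hf, htaylor_apply] using hn _ hθ

theorem mem_closure_range_circlePoly_of_diffContOnCl {h : ℂ → ℂ}
    (hh : DiffContOnCl ℂ h (ball 0 1)) {f : C(UnitAddCircle, ℂ)}
    (hf : ∀ θ, f θ = h (fourier 1 θ)) : f ∈ closure (Set.range circlePoly) := by
  -- The dilations `z ↦ h (r z)` with `r < 1` converge uniformly to `h`.
  rw [← closure_closure]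
  refine Metric.mem_closure_iff.mpr fun ε hε => ?_
  obtain ⟨δ, hδ, hδε⟩ := Metric.uniformContinuousOn_iff.mp
    ((isCompact_closedBall 0 1).uniformContinuousOn_of_continuous hh.continuousOn_ball) ε hε
  obtain ⟨r, hr, hr1⟩ := exists_between (max_lt (sub_lt_self 1 hδ) one_pos)
  lift r to ℝ≥0 using (le_max_right _ _).trans hr.le
  obtain ⟨R, hrR, hR1⟩ := exists_between (show r < 1 by exact_mod_cast hr1)
  have hmem (θ : UnitAddCircle) : (r : ℂ) * fourier 1 θ ∈ closedBall (0 : ℂ) 1 := by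
    rw [mem_closedBall_zero_iff, norm_mul, norm_fourier_one, mul_one]
    simpa using hr1.le
  let g : C(UnitAddCircle, ℂ) :=
    ⟨fun θ => h (r * fourier 1 θ), hh.continuousOn_ball.comp_continuous (by fun_prop) hmem⟩
  refine ⟨g, mem_closure_range_circlePoly_of_differentiableOn hrR (hh.differentiableOn.mono
    (closedBall_subset_ball (by exact_mod_cast hR1))) fun _ => rfl,
    (ContinuousMap.dist_lt_iff hε).mpr fun θ => ?_⟩
  rw [hf]
  refine hδε _ (mem_closedBall_zero_iff.mpr (norm_fourier_one θ).le) _ (hmem θ) ?_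
  have hsub : fourier 1 θ - r * fourier 1 θ = ((1 - r : ℝ) : ℂ) * fourier 1 θ := by
    push_cast; ring
  rw [dist_eq_norm, hsub, norm_mul, norm_fourier_one, mul_one, Complex.norm_real,
    Real.norm_of_nonneg (sub_nonneg.mpr hr1.le)]
  linarith [(le_max_left _ _).trans_lt hr]

theorem IsHankelBound.norm_le_l1Seminorm {l : ℂ[X] →ₗ[ℂ] ℂ} {c : ℝ≥0}
    (h : IsHankelBound circlePolyL2 l c) (P : ℂ[X]) :
    ‖l P‖ ≤ c * l1Seminorm AddCircle.haarAddCircle (circlePolyL2 P) := by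
  obtain ⟨F, G, hF, hG, hFG⟩ := hasBalancedFactorization_eval P
  have continuous_restrict {u : ℂ → ℂ} (hu : DiffContOnCl ℂ u (ball 0 1)) :
      Continuous fun θ : UnitAddCircle => u (fourier 1 θ) :=
    hu.continuousOn_ball.comp_continuous (by fun_prop) fun θ =>
      mem_closedBall_zero_iff.mpr (norm_fourier_one θ).le
  let F' : C(UnitAddCircle, ℂ) := ⟨_, continuous_restrict hF⟩
  let G' : C(UnitAddCircle, ℂ) := ⟨_, continuous_restrict hG⟩
  have hP : circlePoly P = F' * G' := by
    ext θ
    exact (circlePoly_apply P θ).trans (hFG _ (norm_fourier_one θ)).1.symm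
  calc ‖l P‖ ≤ c * (‖ContinuousMap.toLp 2 AddCircle.haarAddCircle ℂ F'‖ *
        ‖ContinuousMap.toLp 2 AddCircle.haarAddCircle ℂ G'‖) :=
        h.norm_le_of_mem_closure (mem_closure_range_circlePoly_of_diffContOnCl hF fun _ => rfl)
          (mem_closure_range_circlePoly_of_diffContOnCl hG fun _ => rfl) hP
    _ = c * ∫ θ, ‖circlePoly P θ‖ ∂AddCircle.haarAddCircle := by
        rw [norm_toLp_mul_norm_toLp_of_norm_eq fun θ => (hFG _ (norm_fourier_one θ)).2, hP]
    _ = c * l1Seminorm AddCircle.haarAddCircle (circlePolyL2 P) :=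
        congrArg _ (l1Seminorm_toLp_continuousMap _).symm

/-- **Nehari's theorem**, with its sharp constant. -/
theorem IsHankelBound.exists_symbol {l : ℂ[X] →ₗ[ℂ] ℂ} {c : ℝ≥0}
    (h : IsHankelBound circlePolyL2 l c) :
    ∃ ψ : Lp ℂ 2 (AddCircle.haarAddCircle : Measure UnitAddCircle),
      (∀ᵐ θ ∂AddCircle.haarAddCircle, ‖ψ θ‖ ≤ c) ∧ ∀ P, inner ℂ ψ (circlePolyL2 P) = l P :=
  exists_symbol_of_norm_le_l1Seminorm circlePolyL2 l c h.norm_le_l1Seminorm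

end Circle

section DisjointVars

variable {σ R : Type*} [CommSemiring R]

/-- A linear functional on polynomials, normalized by `l 1 = 1`, that is multiplicative on products
of polynomials without common variables; for the Bohr lift this is the multiplicativity of the
Dirichlet coefficients. -/
def IsMultiplicativeOnDisjointVars (l : MvPolynomial σ R →ₗ[R] R) : Prop :=
  l 1 = 1 ∧ ∀ p q, Disjoint p.vars q.vars → l (p * q) = l p * l q

theorem IsMultiplicativeOnDisjointVars.of_monomial {l : MvPolynomial σ R →ₗ[R] R} (h1 : l 1 = 1)
    (hmul : ∀ k m : σ →₀ ℕ, Disjoint k.support m.support →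
      l (MvPolynomial.monomial (k + m) 1) =
        l (MvPolynomial.monomial k 1) * l (MvPolynomial.monomial m 1)) :
    IsMultiplicativeOnDisjointVars l := by
  refine ⟨h1, fun p q hpq => ?_⟩
  have hmonomial (k : σ →₀ ℕ) (a : R) :
      l (MvPolynomial.monomial k a) = a * l (MvPolynomial.monomial k 1) := by
    rw [← smul_eq_mul, ← map_smul, MvPolynomial.smul_monomial, smul_eq_mul, mul_one]
  rw [p.as_sum, q.as_sum, Finset.sum_mul_sum]
  simp only [map_sum, Finset.sum_mul_sum, MvPolynomial.monomial_mul]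
  refine Finset.sum_congr rfl fun k hk => Finset.sum_congr rfl fun m hm => ?_
  rw [hmonomial (k + m), hmul k m (hpq.mono (MvPolynomial.support_subset_vars_of_mem_support hk)
    (MvPolynomial.support_subset_vars_of_mem_support hm)), hmonomial k (p.coeff k),
    hmonomial m (q.coeff m)]
  ring

theorem vars_toMvPolynomial_subset (i : σ) (F : R[X]) :
    (Polynomial.toMvPolynomial i F).vars ⊆ {i} := by
  classical
  rw [Polynomial.toMvPolynomial_eq_rename_comp]
  refine (MvPolynomial.vars_rename _ _).trans fun j hj => ?_
  obtain ⟨_, _, rfl⟩ := Finset.mem_image.mp hj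
  exact Finset.mem_singleton_self _

theorem IsMultiplicativeOnDisjointVars.map_prod_toMvPolynomial {l : MvPolynomial σ R →ₗ[R] R}
    (hl : IsMultiplicativeOnDisjointVars l) (s : Finset σ) (F : σ → R[X]) :
    l (∏ j ∈ s, Polynomial.toMvPolynomial j (F j)) =
      ∏ j ∈ s, l (Polynomial.toMvPolynomial j (F j)) := by
  classical
  induction s using Finset.induction_on with
  | empty => simpa using hl.1
  | insert i s hi ih =>
    have hvars : (∏ j ∈ s, Polynomial.toMvPolynomial j (F j)).vars ⊆ s :=
      (MvPolynomial.vars_prod _).trans (Finset.biUnion_subset.mpr fun j hj =>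
        (vars_toMvPolynomial_subset j _).trans (Finset.singleton_subset_iff.mpr hj))
    rw [Finset.prod_insert hi, Finset.prod_insert hi, hl.2 _ _ ?_, ih]
    exact (Finset.disjoint_singleton_left.mpr hi).mono (vars_toMvPolynomial_subset i _) hvars

theorem eq_of_forall_prod_toMvPolynomial {M : Type*} [AddCommMonoid M] [Module R M]
    {l₁ l₂ : MvPolynomial σ R →ₗ[R] M} {s : Finset σ}
    (h : ∀ F : σ → R[X], l₁ (∏ j ∈ s, Polynomial.toMvPolynomial j (F j)) =
      l₂ (∏ j ∈ s, Polynomial.toMvPolynomial j (F j)))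
    {p : MvPolynomial σ R} (hp : p.vars ⊆ s) : l₁ p = l₂ p := by
  have hmonomial {k : σ →₀ ℕ} (hk : k.support ⊆ s) (a : R) : MvPolynomial.monomial k a =
      a • ∏ j ∈ s, Polynomial.toMvPolynomial j (Polynomial.X ^ k j) := by
    rw [MvPolynomial.monomial_eq, Finsupp.prod_of_support_subset k hk _ (by simp),
      ← MvPolynomial.smul_eq_C_mul]
    simp
  rw [p.as_sum]
  simp only [map_sum]
  refine Finset.sum_congr rfl fun k hk => ?_
  rw [hmonomial ((MvPolynomial.support_subset_vars_of_mem_support hk).trans hp), map_smul,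
    map_smul, h]

end DisjointVars

section ProductMeasure

theorem integral_prod_infinitePi {ι 𝕜 : Type*} [RCLike 𝕜] {X : ι → Type*}
    [∀ i, MeasurableSpace (X i)] (μ : ∀ i, Measure (X i)) [∀ i, IsProbabilityMeasure (μ i)]
    (s : Finset ι) {f : ∀ i, X i → 𝕜} (hf : ∀ i, StronglyMeasurable (f i)) :
    ∫ x, ∏ i ∈ s, f i (x i) ∂Measure.infinitePi μ = ∏ i ∈ s, ∫ x, f i x ∂μ i := by
  let g : (∀ i : s, X i) → 𝕜 := fun y => ∏ i : s, f i (y i)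
  have hg : StronglyMeasurable g := Finset.stronglyMeasurable_fun_prod _ fun i _ =>
    (hf i).comp_measurable (measurable_pi_apply i)
  calc ∫ x, ∏ i ∈ s, f i (x i) ∂Measure.infinitePi μ
      = ∫ x, g (s.restrict x) ∂Measure.infinitePi μ :=
        integral_congr_ae (.of_forall fun x => (Finset.prod_coe_sort s fun i => f i (x i)).symm)
    _ = ∫ y, g y ∂Measure.pi fun i : s => μ i :=
        integral_restrict_infinitePi μ hg.aestronglyMeasurable
    _ = ∏ i : s, ∫ x, f i x ∂μ i := integral_fintype_prod_eq_prod fun (i : s) x => f i x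
    _ = ∏ i ∈ s, ∫ x, f i x ∂μ i := Finset.prod_coe_sort s fun i => ∫ x, f i x ∂μ i

end ProductMeasure

theorem inner_toLp_of_ae_eq {X : Type*} [TopologicalSpace X] [CompactSpace X] [MeasurableSpace X]
    [BorelSpace X] {μ : Measure X} [IsFiniteMeasure μ] {ψ : Lp ℂ 2 μ} {u : X → ℂ} (h : ψ =ᵐ[μ] u)
    (f : C(X, ℂ)) : inner ℂ ψ (ContinuousMap.toLp 2 μ ℂ f) = ∫ x, f x * conj (u x) ∂μ := by
  rw [L2.inner_def]
  refine integral_congr_ae ?_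
  filter_upwards [h, ContinuousMap.coeFn_toLp (p := 2) (𝕜 := ℂ) μ f] with x hψ hf
  rw [hψ, hf, RCLike.inner_apply]

section Torus

theorem torusPoly_toMvPolynomial (j : ℕ) (F : ℂ[X]) (θ : UnitAddTorus ℕ) :
    torusPoly (Polynomial.toMvPolynomial j F) θ = circlePoly F (θ j) := by
  have hcoord : torusCoord j θ = fourier 1 (θ j) := by
    rw [fourier_apply, one_smul]; rfl
  have h := Polynomial.aeval_algHom_apply (ContinuousMap.evalAlgHom ℂ ℂ θ) (torusCoord j) F
  rw [Polynomial.coe_aeval_eq_eval] at h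
  rw [torusPoly, MvPolynomial.aeval_toMvPolynomial, circlePoly_apply, ← hcoord]
  exact h.symm

theorem torusPoly_prod_toMvPolynomial (s : Finset ℕ) (F : ℕ → ℂ[X]) (θ : UnitAddTorus ℕ) :
    torusPoly (∏ j ∈ s, Polynomial.toMvPolynomial j (F j)) θ =
      ∏ j ∈ s, circlePoly (F j) (θ j) := by
  simp only [map_prod, ContinuousMap.prod_apply, torusPoly_toMvPolynomial]

theorem norm_torusPolyL2_prod_toMvPolynomial (s : Finset ℕ) (F : ℕ → ℂ[X]) :
    ‖torusPolyL2 (∏ j ∈ s, Polynomial.toMvPolynomial j (F j))‖ =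
      ∏ j ∈ s, ‖circlePolyL2 (F j)‖ := by
  rw [← pow_left_inj₀ (norm_nonneg _) (Finset.prod_nonneg fun _ _ => norm_nonneg _) two_ne_zero]
  calc ‖torusPolyL2 (∏ j ∈ s, Polynomial.toMvPolynomial j (F j))‖ ^ 2
      = ∫ θ, ∏ j ∈ s, ‖circlePoly (F j) (θ j)‖ ^ 2 ∂torusMeasure := by
        refine (norm_toLp_two_sq _).trans (integral_congr_ae (.of_forall fun θ => ?_))
        simp only [AlgHom.toLinearMap_apply, torusPoly_prod_toMvPolynomial, norm_prod,
          Finset.prod_pow]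
    _ = ∏ j ∈ s, ∫ x, ‖circlePoly (F j) x‖ ^ 2 ∂AddCircle.haarAddCircle :=
        integral_prod_infinitePi (f := fun j x => ‖circlePoly (F j) x‖ ^ 2) _ s fun j =>
          Continuous.stronglyMeasurable (by fun_prop)
    _ = (∏ j ∈ s, ‖circlePolyL2 (F j)‖) ^ 2 := by
        rw [← Finset.prod_pow]
        exact Finset.prod_congr rfl fun j _ => (norm_toLp_two_sq _).symm

theorem norm_torusPolyL2_toMvPolynomial (j : ℕ) (F : ℂ[X]) :
    ‖torusPolyL2 (Polynomial.toMvPolynomial j F)‖ = ‖circlePolyL2 F‖ := by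
  simpa using norm_torusPolyL2_prod_toMvPolynomial {j} fun _ => F

theorem exists_tensor_symbol
    {ψ : ℕ → Lp ℂ 2 (AddCircle.haarAddCircle : Measure UnitAddCircle)} {c : ℕ → ℝ≥0}
    (hψ : ∀ j, ∀ᵐ x ∂AddCircle.haarAddCircle, ‖ψ j x‖ ≤ c j) (s : Finset ℕ) :
    ∃ Ψ : TorusL2, (∀ᵐ θ ∂torusMeasure, ‖Ψ θ‖ ≤ ∏ j ∈ s, (c j : ℝ)) ∧
      ∀ F : ℕ → ℂ[X], inner ℂ Ψ (torusPolyL2 (∏ j ∈ s, Polynomial.toMvPolynomial j (F j))) =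
        ∏ j ∈ s, inner ℂ (ψ j) (circlePolyL2 (F j)) := by
  let u : UnitAddTorus ℕ → ℂ := fun θ => ∏ j ∈ s, ψ j (θ j)
  have hu : StronglyMeasurable u := Finset.stronglyMeasurable_fun_prod _ fun j _ =>
    (Lp.stronglyMeasurable (ψ j)).comp_measurable (measurable_pi_apply j)
  have hu_le : ∀ᵐ θ ∂torusMeasure, ‖u θ‖ ≤ ∏ j ∈ s, (c j : ℝ) := by
    have hcoord (j : ℕ) : ∀ᵐ θ ∂torusMeasure, ‖ψ j (θ j)‖ ≤ c j :=
      (measurePreserving_eval_infinitePi (fun _ : ℕ => AddCircle.haarAddCircle)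
        j).quasiMeasurePreserving.ae (hψ j)
    filter_upwards [ae_all_iff.mpr hcoord] with θ hθ
    rw [norm_prod]
    exact Finset.prod_le_prod (fun _ _ => norm_nonneg _) fun j _ => hθ j
  have hu_mem : MemLp u 2 torusMeasure := MemLp.of_bound hu.aestronglyMeasurable _ hu_le
  refine ⟨hu_mem.toLp u, ?_, fun F => ?_⟩
  · filter_upwards [hu_le, hu_mem.coeFn_toLp] with θ hθ hθ'
    rwa [hθ']
  calc inner ℂ (hu_mem.toLp u) (torusPolyL2 (∏ j ∈ s, Polynomial.toMvPolynomial j (F j)))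
      = ∫ θ, ∏ j ∈ s, circlePoly (F j) (θ j) * conj (ψ j (θ j)) ∂torusMeasure := by
        refine (inner_toLp_of_ae_eq hu_mem.coeFn_toLp _).trans
          (integral_congr_ae (.of_forall fun θ => ?_))
        simp only [AlgHom.toLinearMap_apply, torusPoly_prod_toMvPolynomial, u,
          map_prod (starRingEnd ℂ), Finset.prod_mul_distrib]
    _ = ∏ j ∈ s, ∫ x, circlePoly (F j) x * conj (ψ j x) ∂AddCircle.haarAddCircle :=
        integral_prod_infinitePi (f := fun j x => circlePoly (F j) x * conj (ψ j x)) _ s fun j =>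
          (ContinuousMap.continuous _).stronglyMeasurable.mul
            (RCLike.continuous_conj.comp_stronglyMeasurable (Lp.stronglyMeasurable (ψ j)))
    _ = ∏ j ∈ s, inner ℂ (ψ j) (circlePolyL2 (F j)) :=
        Finset.prod_congr rfl fun j _ => (inner_toLp_of_ae_eq .rfl _).symm

/-- The functional `P ↦ ⟨P, Φ⟩` on analytic polynomials, which determines the Hankel form of
`Φ`. -/
def pairing (Φ : TorusL2) : MvPolynomial ℕ ℂ →ₗ[ℂ] ℂ :=
  (innerSL ℂ Φ).toLinearMap ∘ₗ torusPolyL2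

theorem pairing_apply (Φ : TorusL2) (P : MvPolynomial ℕ ℂ) :
    pairing Φ P = inner ℂ Φ (torusPolyL2 P) := rfl

/-- The functional induced by `l` on the polynomials in the single variable `z_j`. -/
def restrictVar (l : MvPolynomial ℕ ℂ →ₗ[ℂ] ℂ) (j : ℕ) : ℂ[X] →ₗ[ℂ] ℂ :=
  l ∘ₗ (Polynomial.toMvPolynomial j).toLinearMap

section Restriction

variable {l : MvPolynomial ℕ ℂ →ₗ[ℂ] ℂ} {C : ℝ≥0}

theorem restrictVar_apply (j : ℕ) (F : ℂ[X]) :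
    restrictVar l j F = l (Polynomial.toMvPolynomial j F) := rfl

theorem IsHankelBound.circle_restrictVar (h : IsHankelBound torusPolyL2 l C) (j : ℕ) :
    IsHankelBound circlePolyL2 (restrictVar l j) C := fun F G => by
  have hnorm (F : ℂ[X]) : ‖torusPolyL2 (Polynomial.toMvPolynomial j F)‖₊ = ‖circlePolyL2 F‖₊ :=
    NNReal.eq (norm_torusPolyL2_toMvPolynomial j F)
  rw [restrictVar_apply, map_mul, ← hnorm, ← hnorm]
  exact h _ _

theorem IsHankelBound.prod_restrictVar_le (h : IsHankelBound torusPolyL2 l C)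
    (hl : IsMultiplicativeOnDisjointVars l) {c : ℕ → ℝ≥0}
    (hc : ∀ j, IsLeast {b | IsHankelBound circlePolyL2 (restrictVar l j) b} (c j))
    (s : Finset ℕ) : ∏ j ∈ s, c j ≤ C := by
  refine prod_le_of_isLeast (X := fun _ => ℂ[X] × ℂ[X]) s
    (f := fun j x => ‖restrictVar l j (x.1 * x.2)‖₊)
    (g := fun _ x => ‖circlePolyL2 x.1‖₊ * ‖circlePolyL2 x.2‖₊)
    (fun j => by simpa only [IsHankelBound, Prod.forall] using hc j) fun x => ?_
  have hnorm (F : ℕ → ℂ[X]) : ‖torusPolyL2 (∏ j ∈ s, Polynomial.toMvPolynomial j (F j))‖₊ =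
      ∏ j ∈ s, ‖circlePolyL2 (F j)‖₊ :=
    NNReal.eq (by simpa using norm_torusPolyL2_prod_toMvPolynomial s F)
  have hl_prod := hl.map_prod_toMvPolynomial s fun j => (x j).1 * (x j).2
  simpa only [restrictVar_apply, ← Finset.prod_mul_distrib, ← map_mul, hl_prod, nnnorm_prod,
    hnorm] using h (∏ j ∈ s, Polynomial.toMvPolynomial j (x j).1)
      (∏ j ∈ s, Polynomial.toMvPolynomial j (x j).2)

theorem IsHankelBound.norm_le_l1Seminorm_torus (h : IsHankelBound torusPolyL2 l C)
    (hl : IsMultiplicativeOnDisjointVars l) (P : MvPolynomial ℕ ℂ) :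
    ‖l P‖ ≤ C * l1Seminorm torusMeasure (torusPolyL2 P) := by
  choose c hc using fun j => (h.circle_restrictVar j).exists_isLeast
  choose ψ hψ hψl using fun j => (hc j).1.exists_symbol
  obtain ⟨Ψ, hΨ, hΨl⟩ := exists_tensor_symbol hψ P.vars
  have hΨC : ∀ᵐ θ ∂torusMeasure, ‖Ψ θ‖ ≤ C := hΨ.mono fun θ hθ =>
    hθ.trans (mod_cast h.prod_restrictVar_le hl hc P.vars)
  have hpairing : pairing Ψ P = l P :=
    eq_of_forall_prod_toMvPolynomial (fun F => by
      rw [hl.map_prod_toMvPolynomial]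
      exact (hΨl F).trans (Finset.prod_congr rfl fun j _ => hψl j (F j))) subset_rfl
  rw [← hpairing]
  exact norm_inner_le_of_ae_norm_le hΨC _

end Restriction

theorem IsBoundedHankelForm.exists_isHankelBound {Φ : TorusL2} (h : IsBoundedHankelForm Φ) :
    ∃ C, IsHankelBound torusPolyL2 (pairing Φ) C := by
  obtain ⟨B, hB⟩ := h
  have ht (F : MvPolynomial ℕ ℂ) : ‖hardyPoly F‖ = ‖torusPolyL2 F‖ := rfl
  exact ⟨_, isHankelBound_of_continuousLinearMap B ht hB⟩

theorem isBoundedHankelForm_of_pairing_mul {Φ : TorusL2}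
    (h : ∀ F G, pairing Φ (F * G) = pairing Φ F * pairing Φ G) : IsBoundedHankelForm Φ :=
  let e : hardyH2 →L[ℂ] ℂ := (innerSL ℂ Φ).comp hardyH2.subtypeL
  ⟨e.smulRight e, fun F G => (h F G).symm⟩

theorem eq_rieszProj_of_pairing_eq {Φ Ψ : TorusL2} (hΦ : Φ ∈ hardyH2)
    (h : ∀ P, pairing Φ P = pairing Ψ P) : Φ = rieszProj Ψ := by
  refine (Submodule.eq_starProjection_of_mem_orthogonal hΦ ?_).symm
  rw [hardyH2, Submodule.orthogonal_closure, Submodule.mem_orthogonal']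
  rintro _ ⟨P, rfl⟩
  rw [inner_sub_left]
  exact sub_eq_zero.mpr (h P).symm

theorem IsBoundedHankelForm.exists_eq_rieszProj {Φ : TorusL2} (h : IsBoundedHankelForm Φ)
    (hΦ : Φ ∈ hardyH2) (hmul : IsMultiplicativeOnDisjointVars (pairing Φ)) :
    ∃ (Ψ : UnitAddTorus ℕ → ℂ) (hΨ : MemLp Ψ ∞ torusMeasure),
      Φ = rieszProj ((hΨ.mono_exponent le_top : MemLp Ψ 2 torusMeasure).toLp Ψ) := by
  obtain ⟨C, hC⟩ := h.exists_isHankelBound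
  obtain ⟨Ψ, hΨ, hΨl⟩ := exists_symbol_of_norm_le_l1Seminorm torusPolyL2 (pairing Φ) C
    (hC.norm_le_l1Seminorm_torus hmul)
  refine ⟨Ψ, memLp_top_of_bound (Lp.aestronglyMeasurable Ψ) C hΨ, ?_⟩
  rw [Lp.toLp_coeFn]
  exact eq_rieszProj_of_pairing_eq hΦ fun P => (hΨl P).symm

end Torus

section BohrLift

/-- The integer `∏ p_j ^ k_j` with prime exponents `k`, inverse to `primeExponents`. -/
def natOfExponents (k : ℕ →₀ ℕ) : ℕ :=
  k.prod fun j e => Nat.nth Nat.Prime j ^ e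

theorem natOfExponents_zero : natOfExponents 0 = 1 :=
  Finsupp.prod_zero_index

theorem natOfExponents_add (k m : ℕ →₀ ℕ) :
    natOfExponents (k + m) = natOfExponents k * natOfExponents m :=
  Finsupp.prod_add_index' (by simp) fun _ _ _ => pow_add _ _ _

theorem natOfExponents_ne_zero (k : ℕ →₀ ℕ) : natOfExponents k ≠ 0 :=
  Finset.prod_ne_zero_iff.mpr fun j _ => pow_ne_zero _ (Nat.prime_nth_prime j).ne_zero

theorem nth_prime_injective : Function.Injective (Nat.nth Nat.Prime) :=
  Nat.nth_injective Nat.infinite_setOfPred_prime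

theorem primeExponents_natOfExponents (k : ℕ →₀ ℕ) : primeExponents (natOfExponents k) = k := by
  have hprod : natOfExponents k = (k.mapDomain (Nat.nth Nat.Prime)).prod (· ^ ·) :=
    (Finsupp.prod_mapDomain_index_inj nth_prime_injective).symm
  have hfactorization : (natOfExponents k).factorization = k.mapDomain (Nat.nth Nat.Prime) := by
    rw [hprod]
    refine Nat.prod_pow_factorization_eq_self fun p hp => ?_
    obtain ⟨j, _, rfl⟩ := Finset.mem_image.mp (Finsupp.mapDomain_support hp)
    exact Nat.prime_nth_prime j
  ext j
  rw [primeExponents, Finsupp.comapDomain_apply, hfactorization,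
    Finsupp.mapDomain_apply nth_prime_injective]

theorem coprime_natOfExponents {k m : ℕ →₀ ℕ} (h : Disjoint k.support m.support) :
    (natOfExponents k).Coprime (natOfExponents m) :=
  Nat.Coprime.prod_left fun i hi => Nat.Coprime.prod_right fun j hj =>
    Nat.Coprime.pow _ _ ((Nat.coprime_primes (Nat.prime_nth_prime i) (Nat.prime_nth_prime j)).mpr
      (nth_prime_injective.ne (Finset.disjoint_iff_ne.mp h i hi j hj)))

theorem bohrLift_mem_hardyH2 {α : ArithmeticFunction ℂ} (hα : MemDirichletH2 α) :
    bohrLift α ∈ hardyH2 :=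
  (Submodule.isClosed_topologicalClosure _).mem_of_tendsto (hasSum_bohrLift hα)
    (.of_forall fun _ => Submodule.sum_mem _ fun _ _ =>
      Submodule.smul_mem _ _ (Submodule.le_topologicalClosure _ (LinearMap.mem_range_self _ _)))

theorem pairing_bohrLift_monomial {α : ArithmeticFunction ℂ} (hα : MemDirichletH2 α)
    (k : ℕ →₀ ℕ) (a : ℂ) :
    pairing (bohrLift α) (MvPolynomial.monomial k a) = a * conj (α (natOfExponents k)) := by
  let e (m : ℕ →₀ ℕ) : TorusL2 := torusPolyL2 (MvPolynomial.monomial m 1)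
  have hortho (m : ℕ →₀ ℕ) : inner ℂ (e k) (e m) = if k = m then 1 else 0 :=
    orthonormal_iff_ite.mp orthonormal_monomials k m
  have hcoeff : inner ℂ (e k) (bohrLift α) = α (natOfExponents k) := by
    refine ((hasSum_bohrLift hα).mapL (innerSL ℂ (e k))).unique ?_
    convert hasSum_single (natOfExponents k) fun n hn => ?_ using 1
    · rw [innerSL_apply_apply, inner_smul_right, hortho, primeExponents_natOfExponents,
        if_pos rfl, mul_one]
    · rw [innerSL_apply_apply, inner_smul_right, hortho]
      rcases eq_or_ne n 0 with rfl | hn0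
      · simp
      · rw [if_neg, mul_zero]
        exact fun hk => hn (primeExponents_injOn hn0 (natOfExponents_ne_zero k)
          (hk.symm.trans (primeExponents_natOfExponents k).symm))
  have hmonomial : MvPolynomial.monomial k a = a • MvPolynomial.monomial k (1 : ℂ) := by
    rw [MvPolynomial.smul_monomial, smul_eq_mul, mul_one]
  rw [hmonomial, map_smul, smul_eq_mul, pairing_apply, ← inner_conj_symm, ← hcoeff]

theorem isMultiplicativeOnDisjointVars_pairing_bohrLift {α : ArithmeticFunction ℂ}
    (hφ : MemDirichletH2 α) (hα : α.IsMultiplicative) :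
    IsMultiplicativeOnDisjointVars (pairing (bohrLift α)) := by
  refine .of_monomial ?_ fun k m hkm => ?_
  · have hone := pairing_bohrLift_monomial hφ 0 1
    rwa [natOfExponents_zero, hα.map_one, map_one (starRingEnd ℂ), one_mul] at hone
  · simp only [pairing_bohrLift_monomial hφ, natOfExponents_add,
      hα.map_mul_of_coprime (coprime_natOfExponents hkm), map_mul, one_mul]

theorem pairing_bohrLift_mul {α : ArithmeticFunction ℂ} (hφ : MemDirichletH2 α)
    (hα : ∀ m n : ℕ, α (m * n) = α m * α n) (F G : MvPolynomial ℕ ℂ) :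
    pairing (bohrLift α) (F * G) = pairing (bohrLift α) F * pairing (bohrLift α) G := by
  induction F using MvPolynomial.induction_on' with
  | add p q hp hq => rw [add_mul, map_add, map_add, hp, hq, add_mul]
  | monomial k a =>
    induction G using MvPolynomial.induction_on' with
    | add p q hp hq => rw [mul_add, map_add, map_add, hp, hq, mul_add]
    | monomial m b =>
      simp only [MvPolynomial.monomial_mul, pairing_bohrLift_monomial hφ, natOfExponents_add, hα,
        map_mul]
      ring

end BohrLift

end

theorem theorem6 (α : ArithmeticFunction ℂ) (hφ : MemDirichletH2 α) (hα : α.IsMultiplicative) :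
    (IsBoundedHankelForm (bohrLift α) →
      ∃ (Ψ : UnitAddTorus ℕ → ℂ) (hΨ : MemLp Ψ ∞ torusMeasure),
        bohrLift α = rieszProj ((hΨ.mono_exponent le_top : MemLp Ψ 2 torusMeasure).toLp Ψ)) ∧
    ((∀ m n : ℕ, α (m * n) = α m * α n) → IsBoundedHankelForm (bohrLift α)) :=
  ⟨fun hB => hB.exists_eq_rieszProj (bohrLift_mem_hardyH2 hφ)
      (isMultiplicativeOnDisjointVars_pairing_bohrLift hφ hα),
    fun hmul => isBoundedHankelForm_of_pairing_mul (pairing_bohrLift_mul hφ hmul)⟩
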